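/- Let $\mathcal D$ be a triangulated category whose Grothendieck group $K(\mathcal D)$ is free of finite rank, and let $F\colon\mathcal D\to\mathcal D$ be an exact endofunctor (it commutes with the shift and preserves exact triangles). Let $\mathrm{Stab}(\mathcal D)$ be the set of Bridgeland stability conditions $\sigma=(Z,\mathcal P)$ on $\mathcal D$ with the support property: for some norm on $K(\mathcal D)\otimes\mathbb R$ there is $C>0$ with $|Z(E)|>C\,\|[E]\|$ for all $\sigma$-semistable $E$. For a nonzero object $E$ with Harder–Narasimhan factors $A_1,\dots,A_m$ of phases $\phi_1>\dots>\phi_m$, put $\phi_\sigma^+(E)=\phi_1$, $\phi_\sigma^-(E)=\phi_m$ and, for $t\in\mathbb R$, $m_{\sigma,t}(E)=\sum_{i=1}^m|Z(A_i)|\,e^{\phi_i t}$; put $m_{\sigma,t}(0)=0$. The mass growth of $F$ is $$h_{\sigma,t}(F)=\sup_{E\in\mathcal D}\ \limsup_{n\to\infty}\frac1n\log m_{\sigma,t}(F^nE)\in[-\infty,\infty],\qquad \log 0=-\infty.$$ Give $\mathrm{Stab}(\mathcal D)$ the topology generated by the sets $$B_\varepsilon(\sigma)=\{\tau=(W,\mathcal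 Q) : d(\mathcal P,\mathcal Q)<\varepsilon,\ \|Z-W\|_\sigma<\sin(\pi\varepsilon)\},\qquad \sigma=(Z,\mathcal P)\in\mathrm{Stab}(\mathcal D),\ 0<\varepsilon<\tfrac14,$$ where $d(\mathcal P,\mathcal Q)=\sup_{E\ne0}\max\{|\phi_\sigma^-(E)-\phi_\tau^-(E)|,|\phi_\sigma^+(E)-\phi_\tau^+(E)|\}$ and $\|Z-W\|_\sigma=\sup\{|Z(E)-W(E)|/|Z(E)| : E\ \sigma\text{-semistable}\}$. If $\sigma$ and $\tau$ lie in the same connected component of $\mathrm{Stab}(\mathcal D)$, then $h_{\sigma,t}(F)=h_{\tau,t}(F)$ for every $t\in\mathbb R$. -/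

import Mathlib

open CategoryTheory CategoryTheory.Limits CategoryTheory.Pretriangulated
open scoped ENNReal TensorProduct

universe v u

noncomputable section

namespace Bridgeland

section Definitions

variable (C : Type u) [Category.{v} C] [Preadditive C] [HasZeroObject C] [HasShift C ℤ]
  [∀ n : ℤ, (shiftFunctor C n).Additive] [Pretriangulated C]

/-- The relations `[Y] - [X] - [Z]`, one for each exact triangle `X ⟶ Y ⟶ Z ⟶ X⟦1⟧`. -/
def eulerRelations : Set (FreeAbelianGroup C) :=
  {x | ∃ T : Triangle C, T ∈ distTriang C ∧
    x = FreeAbelianGroup.of T.obj₂ - FreeAbelianGroup.of T.obj₁ - FreeAbelianGroup.of T.obj₃}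

/-- The Grothendieck group `K(C)` of a triangulated category. -/
def GrothendieckGroup : Type u :=
  FreeAbelianGroup C ⧸ AddSubgroup.closure (eulerRelations C)

instance : AddCommGroup (GrothendieckGroup C) :=
  inferInstanceAs (AddCommGroup (FreeAbelianGroup C ⧸ AddSubgroup.closure (eulerRelations C)))

variable {C}

/-- The class `[E]` of an object in the Grothendieck group. -/
def cls (E : C) : GrothendieckGroup C :=
  QuotientAddGroup.mk' (AddSubgroup.closure (eulerRelations C)) (FreeAbelianGroup.of E)

/-- A Harder-Narasimhan filtration of `E` with respect to a family `P φ` (`φ : ℝ`) of full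
subcategories: objects `0 = X 0, X 1, …, X n = E` (`1 ≤ n`) with exact triangles
`X i ⟶ X (i+1) ⟶ A i ⟶ (X i)⟦1⟧`, whose factors `A 0, …, A (n-1)` are nonzero with
`A i ∈ P (φ i)` and `φ 0 > φ 1 > ⋯ > φ (n-1)`. -/
structure HNFiltration (P : ℝ → ObjectProperty C) (E : C) where
  /-- the number of factors -/
  n : ℕ
  n_pos : 0 < n
  /-- the steps of the filtration -/
  X : Fin (n + 1) → C
  /-- the semistable factors -/
  A : Fin n → C
  /-- the phases of the factors -/
  φ : Fin n → ℝ
  strictAnti : StrictAnti φ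
  mem : ∀ i, P (φ i) (A i)
  nonzero : ∀ i, ¬ IsZero (A i)
  bot : IsZero (X 0)
  top : Nonempty (X (Fin.last n) ≅ E)
  triangle : ∀ i : Fin n, ∃ (f : X i.castSucc ⟶ X i.succ) (g : X i.succ ⟶ A i)
    (h : A i ⟶ (X i.castSucc)⟦(1 : ℤ)⟧), Triangle.mk f g h ∈ distTriang C

/-- The largest phase `φ 0` of a Harder-Narasimhan filtration. -/
def HNFiltration.phiPlus {P : ℝ → ObjectProperty C} {E : C} (H : HNFiltration P E) : ℝ :=
  H.φ ⟨0, H.n_pos⟩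

/-- The smallest phase `φ (n-1)` of a Harder-Narasimhan filtration. -/
def HNFiltration.phiMinus {P : ℝ → ObjectProperty C} {E : C} (H : HNFiltration P E) : ℝ :=
  H.φ ⟨H.n - 1, Nat.sub_lt H.n_pos Nat.one_pos⟩

variable (C) in
/-- A Bridgeland stability condition `(Z, P)` on `C` (the support property is separate, see
`StabilityCondition.SupportProperty`). -/
structure StabilityCondition where
  /-- the central charge -/
  Z : GrothendieckGroup C →+ ℂ
  /-- the full subcategories `P φ` -/
  P : ℝ → ObjectProperty C
  iso_mem : ∀ (φ : ℝ) (E E' : C), Nonempty (E ≅ E') → P φ E → P φ E'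
  zero_mem : ∀ (φ : ℝ) (E : C), IsZero E → P φ E
  /-- closure under binary direct sums, stated for any biproduct of `E` and `E'` -/
  sum_mem : ∀ (φ : ℝ) (E E' : C) (b : BinaryBicone E E'), Nonempty b.IsBilimit →
    P φ E → P φ E' → P φ b.pt
  charge : ∀ (φ : ℝ) (E : C), P φ E → ¬ IsZero E →
    ∃ m : ℝ, 0 < m ∧ Z (cls E) = m * Complex.exp (Complex.I * Real.pi * φ)
  /-- `P (φ + 1) = P φ [1]` -/
  shift_mem_iff : ∀ (φ : ℝ) (E : C), P (φ + 1) (E⟦(1 : ℤ)⟧) ↔ P φ E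
  hom_eq_zero : ∀ (φ₁ φ₂ : ℝ) (A₁ A₂ : C), φ₂ < φ₁ → P φ₁ A₁ → P φ₂ A₂ →
    ∀ f : A₁ ⟶ A₂, f = 0
  exists_hn : ∀ E : C, ¬ IsZero E → Nonempty (HNFiltration P E)

namespace StabilityCondition

variable (σ τ : StabilityCondition C)

/-- `E` is `σ`-semistable of phase `φ`: a nonzero object of `P φ`. -/
def IsSemistable (φ : ℝ) (E : C) : Prop := σ.P φ E ∧ ¬ IsZero E

/-- The support property: for some norm on `K(C) ⊗ ℝ` (all norms are equivalent when `K(C)` has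
finite rank) and some `c > 0`, `|Z(E)| > c ‖[E]‖` for all semistable `E`. -/
def SupportProperty : Prop :=
  ∃ N : Seminorm ℝ (ℝ ⊗[ℤ] GrothendieckGroup C), (∀ x, N x = 0 → x = 0) ∧
    ∃ c : ℝ, 0 < c ∧ ∀ (φ : ℝ) (E : C), σ.IsSemistable φ E →
      c * N ((1 : ℝ) ⊗ₜ[ℤ] cls E) < ‖σ.Z (cls E)‖

/-- A Harder-Narasimhan filtration of a nonzero object; it is unique up to isomorphism, so that the
quantities below do not depend on the choice. -/
def hn (E : C) (hE : ¬ IsZero E) : HNFiltration σ.P E := (σ.exists_hn E hE).some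

open scoped Classical in
/-- The mass `m_{σ,t}(E) = ∑ |Z(A_i)| e^{φ_i t}` with parameter `t`, equal to `0` for `E ≅ 0`. -/
def mass (t : ℝ) (E : C) : ℝ :=
  if hE : IsZero E then 0
  else ∑ i : Fin (σ.hn E hE).n,
    ‖σ.Z (cls ((σ.hn E hE).A i))‖ * Real.exp ((σ.hn E hE).φ i * t)

/-- The mass growth `h_{σ,t}(F) = sup_E limsup_n (1/n) log m_{σ,t}(F^n E)` in `[-∞, ∞]`, where
`log 0 = -∞`. -/
def massGrowth (t : ℝ) (F : C ⥤ C) : EReal :=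
  ⨆ E : C, Filter.limsup
    (fun n : ℕ => (((1 / n : ℝ) : ℝ) : EReal) *
      ENNReal.log (ENNReal.ofReal (σ.mass t (F.obj^[n] E))))
    Filter.atTop

/-- The distance `d(P, Q) ∈ [0, ∞]` between the slicings of two stability conditions. -/
def slicingDist : ℝ≥0∞ :=
  ⨆ (E : C) (hE : ¬ IsZero E),
    max (edist (σ.hn E hE).phiMinus (τ.hn E hE).phiMinus)
      (edist (σ.hn E hE).phiPlus (τ.hn E hE).phiPlus)

/-- `‖Z - W‖_σ = sup { |Z(E) - W(E)| / |Z(E)| : E σ-semistable } ∈ [0, ∞]`, where `Z` and `W` are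
the central charges of `σ` and `τ`. -/
def chargeDist : ℝ≥0∞ :=
  ⨆ (φ : ℝ) (E : C) (_ : σ.IsSemistable φ E),
    ENNReal.ofReal (‖σ.Z (cls E) - τ.Z (cls E)‖ / ‖σ.Z (cls E)‖)

end StabilityCondition

variable (C) in
/-- The set `Stab(C)` of stability conditions with the support property. -/
def Stab : Type u := {σ : StabilityCondition C // σ.SupportProperty}

/-- The set `B_ε(σ)`. -/
def Stab.basicBall (σ : Stab C) (ε : ℝ) : Set (Stab C) :=
  {τ | σ.1.slicingDist τ.1 < ENNReal.ofReal ε ∧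
    σ.1.chargeDist τ.1 < ENNReal.ofReal (Real.sin (Real.pi * ε))}

/-- The topology of `Stab(C)`, generated by the sets `B_ε(σ)` with `0 < ε < 1/4`. -/
instance : TopologicalSpace (Stab C) :=
  TopologicalSpace.generateFrom
    {B | ∃ (σ : Stab C) (ε : ℝ), 0 < ε ∧ ε < 1 / 4 ∧ B = σ.basicBall ε}

end Definitions

end Bridgeland

end

/-! Mass growth is locally constant on `Stab C`, hence constant on connected components. For `τ` in
the ball of radius 1/6 about `σ`, the masses `m_{σ,t}` and `m_{τ,t}` bound each other up to
constants depending only on `t`, and such constants vanish in `(1/n) log` as `n → ∞`.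

To compare masses, use the triangle inequality `mass_le_add` along the HN filtration of one
condition to reduce to its semistable objects (`mass_le_mul_mass`). The HN factors of such an object
for the other condition have phases within 1/6 of its own, so their charges lie in a narrow sector
and nearly add up in norm (`sum_norm_charge_le`).

The triangle inequality comes from writing mass, up to a positive constant, as the integral over `c`
of `e^{ct} Im(e^{-iπc} Z(E'))`, with `E'` the part of `E` of phases in `(c, c+1]`. For an exact
triangle `D → E → F`, truncation above `c` is additive in `K(C)` up to subtracting the class of some
`K_c ∈ P((c, c+1])` (`exists_eq_add_sub`). Both error terms, `-[K_c]` and `+[K_{c+1}]`, have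
nonpositive imaginary part after rotation by `-πc`, so the inequality already holds for the
integrands. -/

noncomputable section

namespace Bridgeland

/-! ### Extensions and classes in the Grothendieck group -/

section ExactTriangles

variable {C : Type u} [Category.{v} C] [Preadditive C] [HasZeroObject C] [HasShift C ℤ]
  [∀ n : ℤ, (shiftFunctor C n).Additive] [Pretriangulated C]

/-- There is an exact triangle `X ⟶ Y ⟶ Z ⟶ X⟦1⟧`. -/
def IsExtension (X Y Z : C) : Prop :=
  ∃ (f : X ⟶ Y) (g : Y ⟶ Z) (h : Z ⟶ X⟦(1 : ℤ)⟧), Triangle.mk f g h ∈ distTriang C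

namespace IsExtension

lemma rotate {X Y Z : C} (h : IsExtension X Y Z) : IsExtension Y Z (X⟦(1 : ℤ)⟧) := by
  obtain ⟨f, g, k, hT⟩ := h
  exact ⟨_, _, _, rot_of_distTriang _ hT⟩

lemma shift {X Y Z : C} (h : IsExtension X Y Z) :
    IsExtension (X⟦(1 : ℤ)⟧) (Y⟦(1 : ℤ)⟧) (Z⟦(1 : ℤ)⟧) :=
  h.rotate.rotate.rotate

lemma of_iso_left {X Y Z : C} (e : X ≅ Y) (hZ : IsZero Z) : IsExtension X Y Z :=
  ⟨e.hom, 0, 0, (Triangle.distinguished_iff_of_isZero₃ (Triangle.mk e.hom (0 : Y ⟶ Z) 0) hZ).2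
    (inferInstanceAs (IsIso e.hom))⟩

lemma of_iso_right {X Y Z : C} (e : Y ≅ Z) (hX : IsZero X) : IsExtension X Y Z :=
  ⟨0, e.hom, 0, (Triangle.distinguished_iff_of_isZero₁ (Triangle.mk (0 : X ⟶ Y) e.hom 0) hX).2
    (inferInstanceAs (IsIso e.hom))⟩

lemma cls_eq {X Y Z : C} (h : IsExtension X Y Z) : cls Y = cls X + cls Z := by
  obtain ⟨f, g, k, hT⟩ := h
  have h0 : QuotientAddGroup.mk' (AddSubgroup.closure (eulerRelations C))
      (FreeAbelianGroup.of Y - FreeAbelianGroup.of X - FreeAbelianGroup.of Z) = 0 :=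
    (QuotientAddGroup.eq_zero_iff _).2 (AddSubgroup.subset_closure ⟨_, hT, rfl⟩)
  rw [map_sub, map_sub, sub_sub, sub_eq_zero] at h0
  exact h0

/-- The octahedral axiom, as half of the associativity of extensions. -/
lemma assoc_right [IsTriangulated C] {X₁ X X₂ E E' : C} (h₁ : IsExtension X₁ X X₂)
    (h₂ : IsExtension X E E') : ∃ Y, IsExtension X₁ E Y ∧ IsExtension X₂ Y E' := by
  obtain ⟨f, g, k, hT⟩ := h₁
  obtain ⟨f', g', k', hT'⟩ := h₂
  obtain ⟨Y, p, q, hY⟩ := distinguished_cocone_triangle (f ≫ f')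
  exact ⟨Y, ⟨_, _, _, hY⟩, _, _, _, (Triangulated.someOctahedron rfl hT hT' hY).mem⟩

/-- The octahedral axiom, as the other half of the associativity of extensions. -/
lemma assoc_left [IsTriangulated C] {X E E' E₁ E₂ : C} (h₁ : IsExtension X E E')
    (h₂ : IsExtension E₁ E' E₂) : ∃ Y, IsExtension X Y E₁ ∧ IsExtension Y E E₂ := by
  obtain ⟨f, g, k, hT⟩ := h₁
  obtain ⟨f', g', k', hT'⟩ := h₂
  obtain ⟨Y, p, q, hY⟩ := distinguished_cocone_triangle₁ (g ≫ g')
  exact ⟨Y, ⟨_, _, _, (Triangulated.someOctahedron' rfl hT hT' hY).mem⟩, _, _, _, hY⟩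

end IsExtension

lemma cls_eq_zero {X : C} (h : IsZero X) : cls X = 0 := by
  have := (IsExtension.of_iso_left (Iso.refl X) h).cls_eq
  simpa using this

lemma cls_eq_of_iso {X Y : C} (e : X ≅ Y) : cls X = cls Y := by
  have := (IsExtension.of_iso_left e (isZero_zero C)).cls_eq
  rw [cls_eq_zero (isZero_zero C), add_zero] at this
  exact this.symm

end ExactTriangles

/-! ### Extension closures and truncation by phase -/

namespace StabilityCondition

variable {C : Type u} [Category.{v} C] [Preadditive C] [HasZeroObject C] [HasShift C ℤ]
  [∀ n : ℤ, (shiftFunctor C n).Additive] [Pretriangulated C]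
  (σ : StabilityCondition C)

/-- The extension closure `P(S)` of the subcategories `P φ` with `φ ∈ S`. -/
inductive extClosure (S : Set ℝ) : C → Prop
  | of_mem (φ : ℝ) (hφ : φ ∈ S) (E : C) (hE : σ.P φ E) : extClosure S E
  | of_isZero (E : C) (hE : IsZero E) : extClosure S E
  | of_isExtension (X Y Z : C) (h : IsExtension X Y Z) (hX : extClosure S X)
      (hZ : extClosure S Z) : extClosure S Y

variable {σ}

namespace extClosure

lemma mono {S T : Set ℝ} (hST : S ⊆ T) {E : C} (h : σ.extClosure S E) : σ.extClosure T E := by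
  induction h with
  | of_mem φ hφ E hE => exact of_mem φ (hST hφ) E hE
  | of_isZero E hE => exact of_isZero E hE
  | of_isExtension X Y Z h _ _ hX hZ => exact of_isExtension X Y Z h hX hZ

lemma of_iso {S : Set ℝ} {E E' : C} (e : E ≅ E') (h : σ.extClosure S E) : σ.extClosure S E' :=
  of_isExtension _ _ _ (IsExtension.of_iso_left e (isZero_zero C)) h
    (of_isZero _ (isZero_zero C))

lemma shift {S T : Set ℝ} (hST : ∀ φ ∈ S, φ + 1 ∈ T) {E : C} (h : σ.extClosure S E) :
    σ.extClosure T (E⟦(1 : ℤ)⟧) := by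
  induction h with
  | of_mem φ hφ E hE => exact of_mem _ (hST φ hφ) _ ((σ.shift_mem_iff φ E).2 hE)
  | of_isZero E hE => exact of_isZero _ ((shiftFunctor C (1 : ℤ)).map_isZero hE)
  | of_isExtension X Y Z h _ _ hX hZ => exact of_isExtension _ _ _ h.shift hX hZ

lemma hom_eq_zero {S T : Set ℝ} (hST : ∀ s ∈ S, ∀ t ∈ T, t < s) {A B : C}
    (hA : σ.extClosure S A) (hB : σ.extClosure T B) (f : A ⟶ B) : f = 0 := by
  induction hA with
  | of_isZero A hA => exact hA.eq_of_src _ _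
  | of_isExtension X Y Z h _ _ hX hZ =>
    obtain ⟨a, b, c, hT⟩ := h
    obtain ⟨g, hg⟩ : ∃ g : Z ⟶ B, f = b ≫ g := Triangle.yoneda_exact₂ _ hT f (hX _)
    rw [hg, hZ g, comp_zero]
  | of_mem s hs A hA =>
    induction hB with
    | of_isZero B hB => exact hB.eq_of_tgt _ _
    | of_mem t ht B hB => exact σ.hom_eq_zero s t A B (hST s hs t ht) hA hB f
    | of_isExtension X Y Z h _ _ hX hZ =>
      obtain ⟨a, b, c, hT⟩ := h
      obtain ⟨g, hg⟩ : ∃ g : A ⟶ X, f = g ≫ a := Triangle.coyoneda_exact₂ _ hT f (hZ _)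
      rw [hg, hX g, zero_comp]

end extClosure

variable (σ) in
/-- `z` is the class of the part of `E` of phases `> c`: there is an exact triangle
`X ⟶ E ⟶ Y ⟶ X⟦1⟧` with `X ∈ P(>c)`, `Y ∈ P(≤c)` and `[X] = z`. -/
def IsTruncationClass (c : ℝ) (E : C) (z : GrothendieckGroup C) : Prop :=
  ∃ X Y : C, IsExtension X E Y ∧ σ.extClosure (Set.Ioi c) X ∧ σ.extClosure (Set.Iic c) Y ∧
    cls X = z

/-- A morphism between the `P(>c)`-parts is determined by its composition to `E'`. -/
lemma eq_zero_of_comp_eq_zero {c : ℝ} {X X' E Y : C} {f : X ⟶ E} {g : E ⟶ Y}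
    {h : Y ⟶ X⟦(1 : ℤ)⟧} (hT : Triangle.mk f g h ∈ distTriang C)
    (hX' : σ.extClosure (Set.Ioi c) X') (hY : σ.extClosure (Set.Iic c) Y) (a : X' ⟶ X)
    (ha : a ≫ f = 0) : a = 0 := by
  obtain ⟨b, hb⟩ := Triangle.coyoneda_exact₁ _ hT (a⟦(1 : ℤ)⟧') (by
    change a⟦(1 : ℤ)⟧' ≫ f⟦(1 : ℤ)⟧' = 0
    rw [← Functor.map_comp, ha, Functor.map_zero])
  -- The shift of `X'` has phases `> c + 1`, so it has no maps to `Y`.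
  have hb0 : b = 0 := extClosure.hom_eq_zero (S := Set.Ioi (c + 1)) (T := Set.Iic c)
    (fun s hs t ht => by simp only [Set.mem_Ioi, Set.mem_Iic] at hs ht; linarith)
    (hX'.shift (fun s hs => by simpa using hs)) hY b
  rw [hb0, zero_comp] at hb
  exact (Functor.map_eq_zero_iff _).1 hb

namespace IsTruncationClass

/-- Hom-vanishing lets each high-phase part factor through the other; the two factorizations are
mutually inverse. -/
lemma unique {c : ℝ} {E : C} {z z' : GrothendieckGroup C} (h : σ.IsTruncationClass c E z)
    (h' : σ.IsTruncationClass c E z') : z = z' := by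
  obtain ⟨X, Y, ⟨f, g, k, hT⟩, hX, hY, rfl⟩ := h
  obtain ⟨X', Y', ⟨f', g', k', hT'⟩, hX', hY', rfl⟩ := h'
  have hlt : ∀ s ∈ Set.Ioi c, ∀ t ∈ Set.Iic c, t < s := fun s hs t ht => lt_of_le_of_lt ht hs
  obtain ⟨a, ha⟩ : ∃ a : X ⟶ X', f = a ≫ f' :=
    Triangle.coyoneda_exact₂ _ hT' f (extClosure.hom_eq_zero hlt hX hY' _)
  obtain ⟨b, hb⟩ : ∃ b : X' ⟶ X, f' = b ≫ f :=
    Triangle.coyoneda_exact₂ _ hT f' (extClosure.hom_eq_zero hlt hX' hY _)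
  refine cls_eq_of_iso ⟨a, b, ?_, ?_⟩
  · refine sub_eq_zero.1 (eq_zero_of_comp_eq_zero hT hX hY _ ?_)
    rw [Preadditive.sub_comp, Category.assoc, ← hb, ← ha, Category.id_comp, sub_self]
  · refine sub_eq_zero.1 (eq_zero_of_comp_eq_zero hT' hX' hY' _ ?_)
    rw [Preadditive.sub_comp, Category.assoc, ← ha, ← hb, Category.id_comp, sub_self]

lemma of_mem {c : ℝ} {E : C} (h : σ.extClosure (Set.Ioi c) E) :
    σ.IsTruncationClass c E (cls E) :=
  ⟨E, _, IsExtension.of_iso_left (Iso.refl E) (isZero_zero C), h,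
    .of_isZero _ (isZero_zero C), rfl⟩

variable [IsTriangulated C]

lemma extend_right {c : ℝ} {X E Y : C} {z : GrothendieckGroup C}
    (hX : σ.IsTruncationClass c X z) (h : IsExtension X E Y) (hY : σ.extClosure (Set.Iic c) Y) :
    σ.IsTruncationClass c E z := by
  obtain ⟨X₁, X₂, hX, h₁, h₂, rfl⟩ := hX
  obtain ⟨Y', h', h''⟩ := hX.assoc_right h
  exact ⟨X₁, Y', h', h₁, .of_isExtension _ _ _ h'' h₂ hY, rfl⟩

lemma extend_left {c : ℝ} {X E Y : C} {z : GrothendieckGroup C}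
    (hY : σ.IsTruncationClass c Y z) (h : IsExtension X E Y) (hX : σ.extClosure (Set.Ioi c) X) :
    σ.IsTruncationClass c E (cls X + z) := by
  obtain ⟨Y₁, Y₂, hY, h₁, h₂, rfl⟩ := hY
  obtain ⟨W, h', h''⟩ := h.assoc_left hY
  exact ⟨W, Y₂, h'', .of_isExtension _ _ _ h' hX h₁, h₂, h'.cls_eq⟩

lemma of_iso {c : ℝ} {E E' : C} {z : GrothendieckGroup C}
    (h : σ.IsTruncationClass c E z) (e : E ≅ E') : σ.IsTruncationClass c E' z :=
  h.extend_right (IsExtension.of_iso_left e (isZero_zero C)) (.of_isZero _ (isZero_zero C))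

/-- Additivity of truncation classes on exact triangles holds up to the class of an object
of `P((c, c + 1])`, the image of a connecting morphism. -/
lemma exists_eq_add_sub {c : ℝ} {D E F : C} {d e f : GrothendieckGroup C} (h : IsExtension D E F)
    (hD : σ.IsTruncationClass c D d) (hE : σ.IsTruncationClass c E e)
    (hF : σ.IsTruncationClass c F f) (hex : ∀ E, ∃ z, σ.IsTruncationClass c E z) :
    ∃ K : C, σ.extClosure (Set.Ioi c) K ∧ σ.extClosure (Set.Iic (c + 1)) K ∧
      e = d + f - cls K := by
  obtain ⟨D₁, D₂, hD, hD₁, hD₂, rfl⟩ := hD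
  obtain ⟨F₁, F₂, hF, hF₁, hF₂, rfl⟩ := hF
  -- `Y` is the preimage of `F₁` in `E`, and `Y'` is `Y` modulo `D₁`, an extension of `F₁` by `D₂`.
  -- Only `Y'` remains to be truncated.
  obtain ⟨Y, hY, hY'⟩ := h.assoc_left hF
  obtain ⟨Y', hY₁, hY₂⟩ := hD.assoc_right hY
  obtain ⟨z, hz⟩ := hex Y'
  have he : e = cls D₁ + z :=
    hE.unique ((hz.extend_left hY₁ hD₁).extend_right hY' hF₂)
  obtain ⟨Z₁, Z₂, hZ, hZ₁, hZ₂, rfl⟩ := hz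
  -- `K` is the cone of `Z₁ → Y' → F₁`. Seen as an extension of `Z₁⟦1⟧` by `F₁` it has phases `> c`;
  -- as one of `D₂⟦1⟧` by `Z₂`, phases `≤ c + 1`.
  obtain ⟨K, hK, hK'⟩ := hZ.assoc_right hY₂.rotate
  refine ⟨K, ?_, ?_, ?_⟩
  · exact .of_isExtension _ _ _ hK.rotate hF₁
      (hZ₁.shift (T := Set.Ioi c) fun s hs => by simp only [Set.mem_Ioi] at hs ⊢; linarith)
  · exact .of_isExtension _ _ _ hK' (hZ₂.mono (Set.Iic_subset_Iic.2 (by linarith)))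
      (hD₂.shift fun s hs => by simpa using hs)
  · rw [he, hK.cls_eq]; abel

end IsTruncationClass

end StabilityCondition

/-! Harder-Narasimhan filtrations -/

namespace HNFiltration

variable {C : Type u} [Category.{v} C] [Preadditive C] [HasZeroObject C] [HasShift C ℤ]
  [∀ n : ℤ, (shiftFunctor C n).Additive] [Pretriangulated C]
  {σ : StabilityCondition C} {E : C} (H : HNFiltration σ.P E)

lemma isExtension (i : Fin H.n) : IsExtension (H.X i.castSucc) (H.X i.succ) (H.A i) :=
  H.triangle i

lemma extClosure_X (S : Set ℝ) (j : Fin (H.n + 1))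
    (h : ∀ i : Fin H.n, i.castSucc < j → H.φ i ∈ S) : σ.extClosure S (H.X j) := by
  induction j using Fin.induction with
  | zero => exact .of_isZero _ H.bot
  | succ k ih =>
    refine .of_isExtension _ _ _ (H.isExtension k) (ih fun i hi => h i ?_)
      (.of_mem _ (h k ?_) _ (H.mem k))
    · exact hi.trans (Fin.castSucc_lt_succ)
    · exact Fin.castSucc_lt_succ

lemma cls_X (j : Fin (H.n + 1)) :
    cls (H.X j) = ∑ i : Fin H.n, if i.castSucc < j then cls (H.A i) else 0 := by
  induction j using Fin.induction with
  | zero => simp [cls_eq_zero H.bot]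
  | succ k ih =>
    rw [(H.isExtension k).cls_eq, ih, ← Finset.sum_filter, ← Finset.sum_filter]
    have : (Finset.univ.filter fun i : Fin H.n => i.castSucc < k.succ) =
        insert k (Finset.univ.filter fun i : Fin H.n => i.castSucc < k.castSucc) := by
      ext i
      simp only [Finset.mem_filter, Finset.mem_univ, true_and, Finset.mem_insert,
        Fin.castSucc_lt_succ_iff, Fin.castSucc_lt_castSucc_iff]
      exact le_iff_eq_or_lt
    rw [this, Finset.sum_insert (by simp), add_comm]

lemma cls_eq_sum : cls E = ∑ i, cls (H.A i) := by
  rw [← cls_eq_of_iso H.top.some, H.cls_X]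
  simp [Fin.castSucc_lt_last]

lemma phiMinus_le (i : Fin H.n) : H.phiMinus ≤ H.φ i :=
  H.strictAnti.antitone (Fin.mk_le_mk.2 (Nat.le_sub_one_of_lt i.2))

lemma le_phiPlus (i : Fin H.n) : H.φ i ≤ H.phiPlus :=
  H.strictAnti.antitone (Fin.mk_le_mk.2 (Nat.zero_le _))

variable [IsTriangulated C]

/-- Phases decrease along the filtration: while they exceed `c` the whole step lies in `P(>c)`;
afterwards each new factor lies in `P(≤c)` and leaves the class unchanged. -/
lemma isTruncationClass_X (c : ℝ) (j : Fin (H.n + 1)) :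
    σ.IsTruncationClass c (H.X j)
      (∑ i : Fin H.n, if i.castSucc < j ∧ c < H.φ i then cls (H.A i) else 0) := by
  induction j using Fin.induction with
  | zero =>
    have := StabilityCondition.IsTruncationClass.of_mem (σ := σ) (c := c)
      (.of_isZero _ H.bot)
    simpa [cls_eq_zero H.bot] using this
  | succ k ih =>
    by_cases hk : c < H.φ k
    · have hlt : ∀ i : Fin H.n, i.castSucc < k.succ → c < H.φ i := fun i hi =>
        hk.trans_le (H.strictAnti.antitone (Fin.castSucc_lt_succ_iff.1 hi))
      have := StabilityCondition.IsTruncationClass.of_mem (H.extClosure_X (Set.Ioi c) k.succ hlt)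
      rw [H.cls_X] at this
      convert this using 4 with i
      exact and_iff_left_of_imp (hlt i)
    · convert ih.extend_right (H.isExtension k)
        (.of_mem _ (Set.mem_Iic.2 (not_lt.1 hk)) _ (H.mem k)) using 3 with i
      rw [Fin.castSucc_lt_succ_iff, Fin.castSucc_lt_castSucc_iff, le_iff_lt_or_eq]
      constructor
      · rintro ⟨h | rfl, h'⟩
        · exact ⟨h, h'⟩
        · exact absurd h' hk
      · exact fun h => ⟨Or.inl h.1, h.2⟩

/-- The class of the part of `E` of phases `> c` is the sum over the factors of phase `> c`. -/
lemma isTruncationClass (c : ℝ) :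
    σ.IsTruncationClass c E (∑ i : Fin H.n, if c < H.φ i then cls (H.A i) else 0) := by
  have := (H.isTruncationClass_X c (Fin.last _)).of_iso H.top.some
  simpa [Fin.castSucc_lt_last] using this

end HNFiltration

/-! ### Rotated central charges and bounds on phases -/

section Charge

variable {C : Type u} [Category.{v} C] [Preadditive C] [HasZeroObject C] [HasShift C ℤ]
  [∀ n : ℤ, (shiftFunctor C n).Additive] [Pretriangulated C]

namespace StabilityCondition

variable (σ : StabilityCondition C)

lemma charge_eq {φ : ℝ} {E : C} (hE : σ.P φ E) :
    σ.Z (cls E) = ‖σ.Z (cls E)‖ * Complex.exp (Complex.I * Real.pi * φ) := by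
  by_cases h0 : IsZero E
  · simp [cls_eq_zero h0]
  · obtain ⟨m, hm, h⟩ := σ.charge φ E hE h0
    have hexp : ‖Complex.exp (Complex.I * Real.pi * φ)‖ = 1 := by
      rw [show Complex.I * Real.pi * φ = ((Real.pi * φ : ℝ) : ℂ) * Complex.I by push_cast; ring,
        Complex.norm_exp_ofReal_mul_I]
    have : ‖σ.Z (cls E)‖ = m := by
      rw [h, norm_mul, hexp, mul_one, Complex.norm_real, Real.norm_of_nonneg hm.le]
    rw [this, h]

/-- The central charge, turned by the angle `-π c`. -/
def rotatedCharge (c : ℝ) : GrothendieckGroup C →+ ℂ :=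
  (AddMonoidHom.mulLeft (Complex.exp (((-(Real.pi * c) : ℝ) : ℂ) * Complex.I))).comp σ.Z

lemma rotatedCharge_apply (c : ℝ) (x : GrothendieckGroup C) :
    σ.rotatedCharge c x = Complex.exp (((-(Real.pi * c) : ℝ) : ℂ) * Complex.I) * σ.Z x := rfl

lemma norm_rotatedCharge (c : ℝ) (x : GrothendieckGroup C) :
    ‖σ.rotatedCharge c x‖ = ‖σ.Z x‖ := by
  rw [rotatedCharge_apply, norm_mul, Complex.norm_exp_ofReal_mul_I, one_mul]

lemma rotatedCharge_add_one (c : ℝ) (x : GrothendieckGroup C) :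
    σ.rotatedCharge (c + 1) x = -σ.rotatedCharge c x := by
  rw [rotatedCharge_apply, rotatedCharge_apply, ← neg_mul (Complex.exp _)]
  congr 1
  rw [show ((-(Real.pi * (c + 1)) : ℝ) : ℂ) * Complex.I =
    ((-(Real.pi * c) : ℝ) : ℂ) * Complex.I - Real.pi * Complex.I by push_cast; ring,
    Complex.exp_sub_pi_mul_I]

lemma rotatedCharge_of_mem (c : ℝ) {φ : ℝ} {E : C} (hE : σ.P φ E) :
    σ.rotatedCharge c (cls E) =
      ‖σ.Z (cls E)‖ * Complex.exp (((Real.pi * (φ - c) : ℝ) : ℂ) * Complex.I) := by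
  rw [rotatedCharge_apply, σ.charge_eq hE, mul_left_comm, ← Complex.exp_add]
  simp only [norm_mul, Complex.norm_real, norm_norm,
    show Complex.I * Real.pi * φ = ((Real.pi * φ : ℝ) : ℂ) * Complex.I by push_cast; ring,
    Complex.norm_exp_ofReal_mul_I, mul_one]
  congr 2
  push_cast
  ring

lemma im_rotatedCharge_of_mem (c : ℝ) {φ : ℝ} {E : C} (hE : σ.P φ E) :
    (σ.rotatedCharge c (cls E)).im = ‖σ.Z (cls E)‖ * Real.sin (Real.pi * (φ - c)) := by
  rw [σ.rotatedCharge_of_mem c hE, Complex.im_ofReal_mul, Complex.exp_ofReal_mul_I_im]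

lemma re_rotatedCharge_of_mem (c : ℝ) {φ : ℝ} {E : C} (hE : σ.P φ E) :
    (σ.rotatedCharge c (cls E)).re = ‖σ.Z (cls E)‖ * Real.cos (Real.pi * (φ - c)) := by
  rw [σ.rotatedCharge_of_mem c hE, Complex.re_ofReal_mul, Complex.exp_ofReal_mul_I_re]

lemma norm_charge_pos {φ : ℝ} {E : C} (hE : σ.P φ E) (h0 : ¬ IsZero E) :
    0 < ‖σ.Z (cls E)‖ := by
  obtain ⟨m, hm, h⟩ := σ.charge φ E hE h0
  rw [norm_pos_iff, h]
  exact mul_ne_zero (by exact_mod_cast hm.ne') (Complex.exp_ne_zero _)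

end StabilityCondition

namespace HNFiltration

variable {σ : StabilityCondition C} {E : C} (H : HNFiltration σ.P E)

lemma lt_phiMinus {c : ℝ} (hE : σ.extClosure (Set.Ioi c) E) : c < H.phiMinus := by
  by_contra! hc
  set l : Fin H.n := ⟨H.n - 1, Nat.sub_lt H.n_pos Nat.one_pos⟩ with hl
  have hφ : H.φ l = H.phiMinus := rfl
  have hlast : l.succ = Fin.last H.n := Fin.ext (by have := H.n_pos; simp [hl]; omega)
  have hX : σ.extClosure (Set.Ioi c) (H.X l.succ) := by
    rw [hlast]; exact hE.of_iso H.top.some.symm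
  have hA : σ.extClosure {H.phiMinus} (H.A l) := .of_mem _ (Set.mem_singleton_iff.2 hφ) _ (H.mem l)
  have hX' : σ.extClosure (Set.Ici H.phiMinus) (H.X l.castSucc) :=
    H.extClosure_X _ _ fun i _ => H.phiMinus_le i
  obtain ⟨f, g, h, hT⟩ := H.isExtension l
  have hg : g = 0 := StabilityCondition.extClosure.hom_eq_zero
    (fun s hs t ht => by rw [Set.mem_singleton_iff.1 ht]; exact hc.trans_lt hs) hX hA g
  -- Since `g = 0`, the identity of the last factor factors through a shift whose phases are all
  -- larger, so the factor would vanish.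
  obtain ⟨k, hk⟩ : ∃ k : (H.X l.castSucc)⟦(1 : ℤ)⟧ ⟶ H.A l, 𝟙 (H.A l) = h ≫ k :=
    Triangle.yoneda_exact₃ _ hT (𝟙 (H.A l)) (by
      change g ≫ 𝟙 (H.A l) = 0
      rw [hg, zero_comp])
  have hk0 : k = 0 := StabilityCondition.extClosure.hom_eq_zero (S := Set.Ioi H.phiMinus)
    (fun s hs t ht => by rw [Set.mem_singleton_iff.1 ht]; exact hs)
    (hX'.shift fun s hs => by simp only [Set.mem_Ici, Set.mem_Ioi] at hs ⊢; linarith) hA k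
  rw [hk0, comp_zero] at hk
  exact H.nonzero l ((IsZero.iff_id_eq_zero _).2 hk)

/-- Truncation above a suitable level gives class zero by uniqueness, yet a positive imaginary part
if the top phase were above `c`. -/
lemma phiPlus_le [IsTriangulated C] {c : ℝ} (hE : σ.extClosure (Set.Iic c) E) :
    H.phiPlus ≤ c := by
  by_contra! hc
  obtain ⟨O, hO⟩ := HasZeroObject.zero (C := C)
  -- The top phase may exceed `c + 1`; raising the level to `b` puts every phase above `b` in `(b, b
  -- + 1)`, where the sine is positive.
  obtain ⟨b, hcb, hb, hb'⟩ : ∃ b, c ≤ b ∧ b < H.phiPlus ∧ H.phiPlus < b + 1 :=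
    ⟨max c (H.phiPlus - 1 / 2), le_max_left _ _, max_lt hc (by linarith),
      by linarith [le_max_right c (H.phiPlus - 1 / 2)]⟩
  have h0 : σ.IsTruncationClass b E (cls O) :=
    (StabilityCondition.IsTruncationClass.of_mem (.of_isZero _ hO)).extend_right
      (IsExtension.of_iso_right (Iso.refl E) hO)
      (hE.mono (Set.Iic_subset_Iic.2 hcb))
  have hsum := congrArg (fun x => (σ.rotatedCharge b x).im) ((H.isTruncationClass b).unique h0)
  simp only [cls_eq_zero hO, map_zero, Complex.zero_im, map_sum,
    Complex.im_sum] at hsum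
  have hpos : ∀ i : Fin H.n, b < H.φ i → 0 < (σ.rotatedCharge b (cls (H.A i))).im := by
    intro i hi
    rw [σ.im_rotatedCharge_of_mem b (H.mem i)]
    have := H.le_phiPlus i
    refine mul_pos (σ.norm_charge_pos (H.mem i) (H.nonzero i)) (Real.sin_pos_of_pos_of_lt_pi ?_ ?_)
    · exact mul_pos Real.pi_pos (by linarith)
    · exact mul_lt_of_lt_one_right Real.pi_pos (by linarith)
  have : 0 < ∑ i, (σ.rotatedCharge b (if b < H.φ i then cls (H.A i) else 0)).im := by
    refine Finset.sum_pos' (fun i _ => ?_) ⟨⟨0, H.n_pos⟩, Finset.mem_univ _, ?_⟩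
    · split_ifs with h
      · exact (hpos i h).le
      · simp
    · have hb₀ : b < H.φ ⟨0, H.n_pos⟩ := hb
      rw [if_pos hb₀]
      exact hpos _ hb₀
  exact this.ne' hsum

variable [IsTriangulated C]

lemma phiPlus_eq_of_mem {φ : ℝ} (hE : σ.P φ E) : H.phiPlus = φ := by
  refine le_antisymm (H.phiPlus_le (.of_mem φ (Set.mem_Iic.2 le_rfl) _ hE)) ?_
  refine le_trans (le_of_forall_lt fun c hc => H.lt_phiMinus (.of_mem φ hc _ hE)) (H.le_phiPlus _)

lemma phiMinus_eq_of_mem {φ : ℝ} (hE : σ.P φ E) : H.phiMinus = φ := by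
  refine le_antisymm ?_ (le_of_forall_lt fun c hc => H.lt_phiMinus (.of_mem φ hc _ hE))
  exact (H.phiMinus_le ⟨0, H.n_pos⟩).trans (H.phiPlus_le (.of_mem φ (Set.mem_Iic.2 le_rfl) _ hE))

end HNFiltration

namespace StabilityCondition

variable (σ : StabilityCondition C) [IsTriangulated C]

lemma im_rotatedCharge_nonneg {c : ℝ} {K : C} (h₁ : σ.extClosure (Set.Ioi c) K)
    (h₂ : σ.extClosure (Set.Iic (c + 1)) K) : 0 ≤ (σ.rotatedCharge c (cls K)).im := by
  by_cases hK : IsZero K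
  · simp [cls_eq_zero hK]
  · have H := σ.hn K hK
    rw [H.cls_eq_sum, map_sum, Complex.im_sum]
    refine Finset.sum_nonneg fun i _ => ?_
    rw [σ.im_rotatedCharge_of_mem c (H.mem i)]
    have := H.lt_phiMinus h₁
    have := H.phiMinus_le i
    have := H.phiPlus_le h₂
    have := H.le_phiPlus i
    refine mul_nonneg (norm_nonneg _) (Real.sin_nonneg_of_nonneg_of_le_pi ?_ ?_)
    · exact mul_nonneg Real.pi_pos.le (by linarith)
    · exact mul_le_of_le_one_right Real.pi_pos.le (by linarith)

end StabilityCondition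

end Charge

/-! The triangle inequality for masses. -/

/-- The function `e^{-ut} sin (π u)` on `(0, 1]`, extended by zero. -/
def massKernel (t : ℝ) : ℝ → ℝ :=
  (Set.Ioc 0 1).indicator fun u => Real.exp (-(u * t)) * Real.sin (Real.pi * u)

lemma integrable_massKernel (t : ℝ) : MeasureTheory.Integrable (massKernel t) := by
  refine MeasureTheory.IntegrableOn.integrable_indicator ?_ measurableSet_Ioc
  exact (Continuous.integrableOn_Icc (by fun_prop)).mono_set Set.Ioc_subset_Icc_self

lemma integral_massKernel_pos (t : ℝ) : 0 < ∫ u, massKernel t u := by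
  unfold massKernel
  rw [MeasureTheory.integral_indicator measurableSet_Ioc,
    ← intervalIntegral.integral_of_le zero_le_one]
  refine intervalIntegral.intervalIntegral_pos_of_pos_on
    (Continuous.intervalIntegrable (by fun_prop) _ _) (fun u hu => ?_) one_pos
  refine mul_pos (Real.exp_pos _) (Real.sin_pos_of_pos_of_lt_pi ?_ ?_)
  · exact mul_pos Real.pi_pos hu.1
  · exact mul_lt_of_lt_one_right Real.pi_pos hu.2

namespace StabilityCondition

variable {C : Type u} [Category.{v} C] [Preadditive C] [HasZeroObject C] [HasShift C ℤ]
  [∀ n : ℤ, (shiftFunctor C n).Additive] [Pretriangulated C]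
  (σ : StabilityCondition C)

open scoped Classical in
/-- The class of the part of `E` of phases `> c`. -/
def truncationClass (c : ℝ) (E : C) : GrothendieckGroup C :=
  if hE : IsZero E then 0
  else ∑ i : Fin (σ.hn E hE).n, if c < (σ.hn E hE).φ i then cls ((σ.hn E hE).A i) else 0

open scoped Classical in
/-- A function of `c` whose integral is proportional to the mass of `E`; at `c` it is
`e^{ct} Im (e^{-iπc} Z(E'))`, where `E'` is the part of `E` of phases in `(c, c + 1]`. -/
def massDensity (t : ℝ) (E : C) (c : ℝ) : ℝ :=
  if hE : IsZero E then 0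
  else ∑ i : Fin (σ.hn E hE).n, ‖σ.Z (cls ((σ.hn E hE).A i))‖ *
    Real.exp ((σ.hn E hE).φ i * t) * massKernel t ((σ.hn E hE).φ i - c)

lemma integrable_massDensity (t : ℝ) (E : C) :
    MeasureTheory.Integrable (σ.massDensity t E) := by
  unfold massDensity
  by_cases hE : IsZero E
  · simp [hE]
  · simp only [hE, dite_false]
    exact MeasureTheory.integrable_finsetSum _ fun i _ =>
      ((integrable_massKernel t).comp_sub_left _).const_mul _

/-- Each factor contributes a reflected translate of the kernel, whose integral does not depend on
the phase. -/
lemma integral_massDensity (t : ℝ) (E : C) :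
    ∫ c, σ.massDensity t E c = σ.mass t E * ∫ u, massKernel t u := by
  unfold massDensity mass
  by_cases hE : IsZero E
  · simp [hE]
  · simp only [hE, dite_false]
    rw [MeasureTheory.integral_finsetSum _ fun i _ =>
      ((integrable_massKernel t).comp_sub_left _).const_mul _, Finset.sum_mul]
    refine Finset.sum_congr rfl fun i _ => ?_
    rw [MeasureTheory.integral_const_mul, MeasureTheory.integral_sub_left_eq_self]

/-- The exponential in the kernel turns `e^{φt}` into `e^{ct}`, common to all factors; what remains
is additive in the class. -/
lemma massDensity_eq (t : ℝ) (E : C) (c : ℝ) :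
    σ.massDensity t E c = Real.exp (c * t) *
      (σ.rotatedCharge c (σ.truncationClass c E - σ.truncationClass (c + 1) E)).im := by
  unfold massDensity truncationClass
  by_cases hE : IsZero E
  · simp [hE]
  · simp only [hE, dite_false, ← Finset.sum_sub_distrib, map_sum, Complex.im_sum, Finset.mul_sum]
    refine Finset.sum_congr rfl fun i _ => ?_
    generalize σ.hn E hE = H at i ⊢
    unfold massKernel
    by_cases h₁ : c < H.φ i
    · by_cases h₂ : c + 1 < H.φ i
      · rw [Set.indicator_of_notMem, if_pos h₁, if_pos h₂]
        · simp
        · simp only [Set.mem_Ioc, not_and, not_le]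
          intro; linarith
      · rw [Set.indicator_of_mem, if_pos h₁, if_neg h₂, sub_zero,
          σ.im_rotatedCharge_of_mem c (H.mem i)]
        · rw [show c * t = H.φ i * t + -((H.φ i - c) * t) by ring, Real.exp_add]
          ring
        · exact ⟨by linarith, by linarith⟩
    · rw [Set.indicator_of_notMem, if_neg h₁, if_neg (by linarith)]
      · simp
      · simp only [Set.mem_Ioc, not_and_or, not_lt]
        left; linarith

variable [IsTriangulated C]

lemma isTruncationClass_truncationClass (c : ℝ) (E : C) :
    σ.IsTruncationClass c E (σ.truncationClass c E) := by
  unfold truncationClass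
  by_cases hE : IsZero E
  · simp only [hE, dite_true]
    rw [← cls_eq_zero hE]
    exact .of_mem (.of_isZero _ hE)
  · simp only [hE, dite_false]
    exact (σ.hn E hE).isTruncationClass c

lemma massDensity_le_add (t : ℝ) {D E F : C} (h : IsExtension D E F) (c : ℝ) :
    σ.massDensity t E c ≤ σ.massDensity t D c + σ.massDensity t F c := by
  have key := fun b => IsTruncationClass.exists_eq_add_sub h
    (σ.isTruncationClass_truncationClass b D) (σ.isTruncationClass_truncationClass b E)
    (σ.isTruncationClass_truncationClass b F)
    fun E => ⟨_, σ.isTruncationClass_truncationClass b E⟩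
  obtain ⟨K, hK, hK', h₁⟩ := key c
  obtain ⟨L, hL, hL', h₂⟩ := key (c + 1)
  have hK₀ := σ.im_rotatedCharge_nonneg hK hK'
  have hL₀ := σ.im_rotatedCharge_nonneg hL hL'
  -- The half turn between levels `c + 1` and `c` reverses the sign, so the error `+[L]` also helps.
  rw [rotatedCharge_add_one, Complex.neg_im] at hL₀
  rw [massDensity_eq, massDensity_eq, massDensity_eq, ← mul_add, h₁, h₂]
  refine mul_le_mul_of_nonneg_left ?_ (Real.exp_pos _).le
  simp only [map_sub, map_add, Complex.sub_im, Complex.add_im]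
  linarith

/-- The triangle inequality for masses. -/
theorem mass_le_add (t : ℝ) {D E F : C} (h : IsExtension D E F) :
    σ.mass t E ≤ σ.mass t D + σ.mass t F := by
  refine le_of_mul_le_mul_right ?_ (integral_massKernel_pos t)
  rw [add_mul, ← integral_massDensity, ← integral_massDensity, ← integral_massDensity,
    ← MeasureTheory.integral_add (σ.integrable_massDensity t D) (σ.integrable_massDensity t F)]
  exact MeasureTheory.integral_mono (σ.integrable_massDensity t E)
    ((σ.integrable_massDensity t D).add (σ.integrable_massDensity t F))
    fun c => σ.massDensity_le_add t h c

end StabilityCondition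

/-! ### Comparison of masses for nearby stability conditions -/

lemma le_sum_of_succ_le {n : ℕ} (f : Fin (n + 1) → ℝ) (g : Fin n → ℝ) (h0 : f 0 ≤ 0)
    (h : ∀ i : Fin n, f i.succ ≤ f i.castSucc + g i) : f (Fin.last n) ≤ ∑ i, g i := by
  induction n with
  | zero => simpa using h0
  | succ n ih =>
    rw [Fin.sum_univ_castSucc]
    exact (h (Fin.last n)).trans (add_le_add_left
      (ih (fun i => f i.castSucc) (fun i => g i.castSucc) h0 fun i => h i.castSucc) _)

namespace StabilityCondition

variable {C : Type u} [Category.{v} C] [Preadditive C] [HasZeroObject C] [HasShift C ℤ]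
  [∀ n : ℤ, (shiftFunctor C n).Additive] [Pretriangulated C]
  (σ τ : StabilityCondition C)

lemma mass_of_isZero (t : ℝ) {E : C} (hE : IsZero E) : σ.mass t E = 0 := dif_pos hE

lemma mass_of_not_isZero (t : ℝ) {E : C} (hE : ¬ IsZero E) :
    σ.mass t E = ∑ i, ‖σ.Z (cls ((σ.hn E hE).A i))‖ * Real.exp ((σ.hn E hE).φ i * t) :=
  dif_neg hE

lemma mass_nonneg (t : ℝ) (E : C) : 0 ≤ σ.mass t E := by
  by_cases hE : IsZero E
  · rw [σ.mass_of_isZero t hE]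
  · rw [σ.mass_of_not_isZero t hE]
    exact Finset.sum_nonneg fun i _ => by positivity

/-- `P` is arbitrary so that the mass of one condition can be estimated along the HN filtration of
another. -/
lemma mass_le_sum [IsTriangulated C] (t : ℝ) {P : ℝ → ObjectProperty C} {E : C}
    (H : HNFiltration P E) : σ.mass t E ≤ ∑ i, σ.mass t (H.A i) := by
  have hE := σ.mass_le_add t (IsExtension.of_iso_left H.top.some (isZero_zero C))
  rw [σ.mass_of_isZero t (isZero_zero C), add_zero] at hE
  exact hE.trans (le_sum_of_succ_le (fun j => σ.mass t (H.X j)) _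
    (σ.mass_of_isZero t H.bot).le fun i => σ.mass_le_add t (H.triangle i))

/-- A bound for the masses of semistable objects extends to all objects. -/
lemma mass_le_mul_mass [IsTriangulated C] {t B : ℝ}
    (h : ∀ (φ : ℝ) (A : C), σ.IsSemistable φ A →
      τ.mass t A ≤ B * (‖σ.Z (cls A)‖ * Real.exp (φ * t))) (E : C) :
    τ.mass t E ≤ B * σ.mass t E := by
  by_cases hE : IsZero E
  · rw [mass_of_isZero _ _ hE, mass_of_isZero _ _ hE, mul_zero]
  · rw [σ.mass_of_not_isZero t hE, Finset.mul_sum]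
    exact (τ.mass_le_sum t (σ.hn E hE)).trans (Finset.sum_le_sum fun i _ =>
      h _ _ ⟨(σ.hn E hE).mem i, (σ.hn E hE).nonzero i⟩)

variable {σ τ}

/-- In a sector of half-angle `π/6` about direction `ψ`, each charge projects to at least `cos(π/6)
≥ 4/5` of its length. -/
lemma sum_norm_charge_le {E : C} (H : HNFiltration σ.P E) {ψ : ℝ}
    (hH : ∀ i, |H.φ i - ψ| ≤ 1 / 6) :
    ∑ i, ‖σ.Z (cls (H.A i))‖ ≤ 5 / 4 * ‖σ.Z (cls E)‖ := by
  have hcos : ∀ i, 4 / 5 ≤ Real.cos (Real.pi * (H.φ i - ψ)) := by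
    intro i
    rw [← Real.cos_abs, abs_mul, abs_of_pos Real.pi_pos]
    have h6 : Real.cos (Real.pi / 6) ≤ Real.cos (Real.pi * |H.φ i - ψ|) :=
      Real.cos_le_cos_of_nonneg_of_le_pi (by positivity) (by linarith [Real.pi_pos])
        (by nlinarith [Real.pi_pos, hH i])
    refine le_trans ?_ h6
    rw [Real.cos_pi_div_six]
    have : (8 / 5 : ℝ) ≤ √3 := Real.le_sqrt_of_sq_le (by norm_num)
    linarith
  have hre : (σ.rotatedCharge ψ (cls E)).re ≤ ‖σ.Z (cls E)‖ :=
    (Complex.re_le_norm _).trans (σ.norm_rotatedCharge ψ _).le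
  rw [H.cls_eq_sum, map_sum, Complex.re_sum] at hre
  rw [← H.cls_eq_sum] at hre
  have hle : ∑ i, ‖σ.Z (cls (H.A i))‖ * (4 / 5) ≤
      ∑ i, (σ.rotatedCharge ψ (cls (H.A i))).re := by
    refine Finset.sum_le_sum fun i _ => ?_
    rw [σ.re_rotatedCharge_of_mem ψ (H.mem i)]
    exact mul_le_mul_of_nonneg_left (hcos i) (norm_nonneg _)
  rw [← Finset.sum_mul] at hle
  linarith

lemma mass_le_of_phases {E : C} (hE : ¬ IsZero E) {ψ : ℝ} (t : ℝ)
    (hH : ∀ i, |(σ.hn E hE).φ i - ψ| ≤ 1 / 6) :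
    σ.mass t E ≤ 5 / 4 * Real.exp |t| * (‖σ.Z (cls E)‖ * Real.exp (ψ * t)) := by
  rw [σ.mass_of_not_isZero t hE]
  have hexp : ∀ i, Real.exp ((σ.hn E hE).φ i * t) ≤ Real.exp |t| * Real.exp (ψ * t) := by
    intro i
    rw [← Real.exp_add, Real.exp_le_exp]
    have h₁ := le_abs_self (((σ.hn E hE).φ i - ψ) * t)
    rw [abs_mul] at h₁
    nlinarith [hH i, abs_nonneg t]
  calc _ ≤ ∑ i, ‖σ.Z (cls ((σ.hn E hE).A i))‖ * (Real.exp |t| * Real.exp (ψ * t)) :=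
        Finset.sum_le_sum fun i _ => mul_le_mul_of_nonneg_left (hexp i) (norm_nonneg _)
    _ ≤ 5 / 4 * ‖σ.Z (cls E)‖ * (Real.exp |t| * Real.exp (ψ * t)) := by
        rw [← Finset.sum_mul]
        exact mul_le_mul_of_nonneg_right (sum_norm_charge_le _ hH) (by positivity)
    _ = _ := by ring

lemma abs_sub_lt_of_edist_lt {x y ε : ℝ} (h : edist x y < ENNReal.ofReal ε) : |x - y| < ε := by
  rw [edist_dist, ENNReal.ofReal_lt_ofReal_iff_of_nonneg dist_nonneg] at h
  exact h

lemma abs_phi_sub_lt {ε : ℝ} (h : σ.slicingDist τ < ENNReal.ofReal ε) (E : C)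
    (hE : ¬ IsZero E) :
    |(σ.hn E hE).phiMinus - (τ.hn E hE).phiMinus| < ε ∧
      |(σ.hn E hE).phiPlus - (τ.hn E hE).phiPlus| < ε := by
  have hle := (le_iSup₂ (f := fun (E : C) (hE : ¬ IsZero E) =>
    max (edist (σ.hn E hE).phiMinus (τ.hn E hE).phiMinus)
      (edist (σ.hn E hE).phiPlus (τ.hn E hE).phiPlus)) E hE).trans_lt h
  exact ⟨abs_sub_lt_of_edist_lt ((le_max_left _ _).trans_lt hle),
    abs_sub_lt_of_edist_lt ((le_max_right _ _).trans_lt hle)⟩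

lemma slicingDist_comm (σ τ : StabilityCondition C) : σ.slicingDist τ = τ.slicingDist σ := by
  unfold slicingDist
  simp only [edist_comm]

lemma slicingDist_self (σ : StabilityCondition C) : σ.slicingDist σ = 0 := by
  simp [slicingDist]

lemma chargeDist_self (σ : StabilityCondition C) : σ.chargeDist σ = 0 := by
  simp [chargeDist]

lemma norm_charge_sub_le {r : ℝ} (h : σ.chargeDist τ < ENNReal.ofReal r) {φ : ℝ} {E : C}
    (hE : σ.P φ E) : ‖σ.Z (cls E) - τ.Z (cls E)‖ ≤ r * ‖σ.Z (cls E)‖ := by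
  by_cases h0 : IsZero E
  · simp [cls_eq_zero h0]
  · have hle := (le_iSup₂_of_le (f := fun (φ : ℝ) (E : C) => ⨆ _ : σ.IsSemistable φ E,
      ENNReal.ofReal (‖σ.Z (cls E) - τ.Z (cls E)‖ / ‖σ.Z (cls E)‖)) φ E
      (le_iSup_of_le ⟨hE, h0⟩ le_rfl)).trans_lt h
    rw [ENNReal.ofReal_lt_ofReal_iff_of_nonneg (by positivity),
      div_lt_iff₀ (σ.norm_charge_pos hE h0)] at hle
    exact hle.le

/-- Mass growth is unchanged when masses are multiplied by bounded factors. -/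
lemma massGrowth_le_of_mass_le {t B : ℝ} (h : ∀ E, τ.mass t E ≤ B * σ.mass t E) (F : C ⥤ C) :
    τ.massGrowth t F ≤ σ.massGrowth t F := by
  refine iSup_mono fun E => ?_
  -- Taking the maximum makes `b` positive, so that `log b` is a finite real.
  set b := max B 1 with hb
  have hb0 : 0 < b := lt_of_lt_of_le one_pos (le_max_right _ _)
  set u : ℕ → EReal := fun n => ((1 / n * Real.log b : ℝ) : EReal)
  set w : ℕ → EReal := fun n => (((1 / n : ℝ) : ℝ) : EReal) *
    ENNReal.log (ENNReal.ofReal (σ.mass t (F.obj^[n] E)))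
  have hu : Filter.Tendsto u Filter.atTop (nhds 0) := by
    have := (tendsto_one_div_atTop_nhds_zero_nat (𝕜 := ℝ)).mul_const (Real.log b)
    rw [zero_mul] at this
    exact (continuous_coe_real_ereal.tendsto 0).comp this
  calc _ ≤ Filter.limsup (u + w) Filter.atTop := by
        refine Filter.limsup_le_limsup (Filter.Eventually.of_forall fun n => ?_)
        have hm : ENNReal.ofReal (τ.mass t (F.obj^[n] E)) ≤
            ENNReal.ofReal b * ENNReal.ofReal (σ.mass t (F.obj^[n] E)) := by
          rw [← ENNReal.ofReal_mul hb0.le]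
          exact ENNReal.ofReal_le_ofReal ((h _).trans
            (mul_le_mul_of_nonneg_right (le_max_left _ _) (σ.mass_nonneg t _)))
        have hlog : ENNReal.log (ENNReal.ofReal b) = (Real.log b : EReal) := by
          rw [ENNReal.log_ofReal_of_pos hb0]
        have hn : (0 : EReal) ≤ (((1 / n : ℝ) : ℝ) : EReal) :=
          EReal.coe_nonneg.2 (by positivity)
        have := mul_le_mul_of_nonneg_left (ENNReal.log_monotone hm) hn
        rw [ENNReal.log_mul_add, EReal.left_distrib_of_nonneg_of_ne_top hn (EReal.coe_ne_top _),
          hlog, ← EReal.coe_mul] at this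
        exact this
    _ ≤ Filter.limsup u Filter.atTop + Filter.limsup w Filter.atTop := by
        refine EReal.limsup_add_le (Or.inl ?_) (Or.inl ?_) <;> rw [hu.limsup_eq]
        · exact EReal.zero_ne_bot
        · exact EReal.zero_ne_top
    _ = _ := by rw [hu.limsup_eq, zero_add]

variable [IsTriangulated C]

lemma abs_phase_sub_le {ε : ℝ} (h : σ.slicingDist τ < ENNReal.ofReal ε) {φ : ℝ} {A : C}
    (hA : σ.P φ A) (h0 : ¬ IsZero A) (i : Fin (τ.hn A h0).n) :
    |(τ.hn A h0).φ i - φ| ≤ ε := by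
  obtain ⟨h₁, h₂⟩ := abs_phi_sub_lt h A h0
  rw [(σ.hn A h0).phiMinus_eq_of_mem hA, abs_lt] at h₁
  rw [(σ.hn A h0).phiPlus_eq_of_mem hA, abs_lt] at h₂
  have := (τ.hn A h0).phiMinus_le i
  have := (τ.hn A h0).le_phiPlus i
  rw [abs_le]
  constructor <;> linarith

lemma mass_le_of_dist_lt (h : σ.slicingDist τ < ENNReal.ofReal (1 / 6))
    (h' : σ.chargeDist τ < ENNReal.ofReal (1 / 2)) (t : ℝ) (E : C) :
    τ.mass t E ≤ 5 / 4 * Real.exp |t| * (3 / 2) * σ.mass t E := by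
  refine mass_le_mul_mass σ τ (fun φ A hA => ?_) E
  refine (mass_le_of_phases hA.2 t (abs_phase_sub_le h hA.1 hA.2)).trans ?_
  rw [mul_assoc (5 / 4 * Real.exp |t|), ← mul_assoc (3 / 2 : ℝ)]
  have := norm_charge_sub_le h' hA.1
  have := norm_sub_norm_le (τ.Z (cls A)) (σ.Z (cls A))
  rw [norm_sub_rev] at this
  gcongr
  linarith

/-- `chargeDist` only controls `σ`-semistable objects, so the `τ`-semistable `B` is split into its
`σ`-factors: `|Z(B) - W(B)| ≤ (1/2)(5/4)|Z(B)|`, whence `|Z(B)| ≤ (8/3)|W(B)|`. -/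
lemma mass_le_of_dist_lt' (h : σ.slicingDist τ < ENNReal.ofReal (1 / 6))
    (h' : σ.chargeDist τ < ENNReal.ofReal (1 / 2)) (t : ℝ) (E : C) :
    σ.mass t E ≤ 5 / 4 * Real.exp |t| * (8 / 3) * τ.mass t E := by
  refine mass_le_mul_mass τ σ (fun ψ B hB => ?_) E
  have hph := abs_phase_sub_le (slicingDist_comm σ τ ▸ h) hB.1 hB.2
  refine (mass_le_of_phases hB.2 t hph).trans ?_
  rw [mul_assoc (5 / 4 * Real.exp |t|), ← mul_assoc (8 / 3 : ℝ)]
  have hsum := sum_norm_charge_le _ hph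
  have hdiff : ‖σ.Z (cls B) - τ.Z (cls B)‖ ≤
      1 / 2 * ∑ i, ‖σ.Z (cls ((σ.hn B hB.2).A i))‖ := by
    rw [(σ.hn B hB.2).cls_eq_sum, map_sum, map_sum, ← Finset.sum_sub_distrib, Finset.mul_sum]
    exact (norm_sum_le _ _).trans
      (Finset.sum_le_sum fun i _ => norm_charge_sub_le h' ((σ.hn B hB.2).mem i))
  have := norm_sub_norm_le (σ.Z (cls B)) (τ.Z (cls B))
  gcongr
  linarith

lemma massGrowth_eq_of_dist_lt (h : σ.slicingDist τ < ENNReal.ofReal (1 / 6))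
    (h' : σ.chargeDist τ < ENNReal.ofReal (1 / 2)) (t : ℝ) (F : C ⥤ C) :
    σ.massGrowth t F = τ.massGrowth t F :=
  le_antisymm (massGrowth_le_of_mass_le (mass_le_of_dist_lt' h h' t) F)
    (massGrowth_le_of_mass_le (mass_le_of_dist_lt h h' t) F)

end StabilityCondition

/-! ### Local constancy of mass growth -/

namespace Stab

variable {C : Type u} [Category.{v} C] [Preadditive C] [HasZeroObject C] [HasShift C ℤ]
  [∀ n : ℤ, (shiftFunctor C n).Additive] [Pretriangulated C]

lemma isOpen_basicBall (σ : Stab C) {ε : ℝ} (h₀ : 0 < ε) (h₁ : ε < 1 / 4) :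
    IsOpen (σ.basicBall ε) :=
  TopologicalSpace.isOpen_generateFrom_of_mem ⟨σ, ε, h₀, h₁, rfl⟩

lemma mem_basicBall_self (σ : Stab C) {ε : ℝ} (h₀ : 0 < ε) (h₁ : ε < 1 / 4) :
    σ ∈ σ.basicBall ε := by
  refine ⟨?_, ?_⟩
  · rw [StabilityCondition.slicingDist_self]
    exact ENNReal.ofReal_pos.2 h₀
  · rw [StabilityCondition.chargeDist_self]
    exact ENNReal.ofReal_pos.2 (Real.sin_pos_of_pos_of_lt_pi (mul_pos Real.pi_pos h₀)
      (mul_lt_of_lt_one_right Real.pi_pos (by linarith)))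

lemma isLocallyConstant_massGrowth [IsTriangulated C] (t : ℝ) (F : C ⥤ C) :
    IsLocallyConstant fun σ : Stab C => σ.1.massGrowth t F := by
  rw [IsLocallyConstant.iff_eventually_eq]
  intro σ
  -- Radius 1/6 meets both bounds at once, as `sin(π/6) = 1/2`.
  filter_upwards [(σ.isOpen_basicBall (ε := 1 / 6) (by norm_num) (by norm_num)).mem_nhds
    (σ.mem_basicBall_self (by norm_num) (by norm_num))] with τ hτ
  refine (StabilityCondition.massGrowth_eq_of_dist_lt hτ.1 ?_ t F).symm
  have := hτ.2
  rwa [mul_one_div, Real.sin_pi_div_six] at this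

end Stab

end Bridgeland

end

theorem proposition3p11 {D : Type u} [Category.{v} D] [Preadditive D] [HasZeroObject D]
    [HasShift D ℤ] [∀ n : ℤ, (shiftFunctor D n).Additive] [Pretriangulated D]
    [IsTriangulated D]
    [Module.Free ℤ (Bridgeland.GrothendieckGroup D)]
    [Module.Finite ℤ (Bridgeland.GrothendieckGroup D)]
    (F : D ⥤ D) [F.CommShift ℤ] [F.IsTriangulated]
    (σ τ : Bridgeland.Stab D) (h : τ ∈ connectedComponent σ) (t : ℝ) :
    σ.1.massGrowth t F = τ.1.massGrowth t F :=
  (Bridgeland.Stab.isLocallyConstant_massGrowth t F).apply_eq_of_isPreconnected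
    isPreconnected_connectedComponent mem_connectedComponent h
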